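/- Let $\mathbb{T}^2=\mathbb{R}^2/\mathbb{Z}^2$ be the flat torus and let $\|x-y\|$ denote the geodesic distance between $x,y\in\mathbb{T}^2$. For $p>0$ and $x_1,\dots,x_5\in\mathbb{T}^2$ consider the Riesz $p$-energy $$E_p(x_1,\dots,x_5)=\sum_{\substack{i,j=1\\ i\neq j}}^{5}\frac{1}{\|x_i-x_j\|^p}\in(0,\infty],$$ where $1/0^p=\infty$, and let $$F_5=\left\{(0,0),\ \left(\tfrac15,\tfrac35\right),\ \left(\tfrac25,\tfrac15\right),\ \left(\tfrac35,\tfrac45\right),\ \left(\tfrac45,\tfrac25\right)\right\}\subset\mathbb{T}^2$$ be the five-point Fibonacci set. There exists $p_0>0$ such that for all $p\ge p_0$ and all $x_1,\dots,x_5\in\mathbb{T}^2$ $$E_p(x_1,\dots,x_5)\ \ge\ 20\cdot 5^{p/2},$$ with equality if and only if $\{x_1,\dots,x_5\}=\varphi(F_5)$ for some isometry $\varphi$ of $\mathbb{T}^2$. In particular, for every $p\geq p_0$, the minimal energy configuration is exactly $F_5$, up to relabeling the points and isometries of the torus. -/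

import Mathlib

open scoped ENNReal

/-- The flat torus `𝕋² = ℝ²/ℤ²`. The distance between the classes of `(a, b)` and `(c, d)` is
`√(d₁(a, c)² + d₁(b, d)²)`, where `d₁(s, t) = min_{k ∈ ℤ} |s - t - k|` is the distance on `ℝ/ℤ`;
this is the geodesic distance of the flat metric. -/
abbrev FlatTorus : Type := WithLp 2 (UnitAddCircle × UnitAddCircle)

/-- The class in `ℝ²/ℤ²` of the point `(a, b)` of the plane. -/
noncomputable def torusPoint (a b : ℝ) : FlatTorus :=
  WithLp.toLp 2 ((a : UnitAddCircle), (b : UnitAddCircle))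

/-- The Riesz `p`-energy `∑_{i ≠ j} 1 / ‖x i - x j‖ ^ p` of `n` labelled points on the flat torus,
the sum being over ordered pairs. It takes values in `[0, ∞]`; for `p > 0` it is `∞` exactly
when two of the points coincide. -/
noncomputable def rieszEnergy {n : ℕ} (p : ℝ) (x : Fin n → FlatTorus) : ℝ≥0∞ :=
  ∑ ij ∈ (Finset.univ : Finset (Fin n)).offDiag, 1 / edist (x ij.1) (x ij.2) ^ p

/-- The five-point Fibonacci set. -/
def fibonacciSet : Set FlatTorus :=
  {torusPoint 0 0, torusPoint (1 / 5) (3 / 5), torusPoint (2 / 5) (1 / 5),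
    torusPoint (3 / 5) (4 / 5), torusPoint (4 / 5) (2 / 5)}

/-! The points of the Fibonacci set have all squared distances equal to `1/5`. From `log t ≤ t - 1`
at `t = 5d²`, each term `1/d^p` is at least `5^(p/2) exp(q(1 - 5d²))` with `q = p/2`, with equality
at `d² = 1/5`. It thus suffices to study configurations whose Gaussian sum over the ten pairs is at
most ten (`sum_exp_le_of_rieszEnergy_le`).

For large `q` such a configuration has all squared distances at least `0.1998`. Sorting by first
coordinate and using that a triangle on a unit circle has perimeter at most one forces the
increments close to `(1/5, ±2/5)` (`gap_bounds`, `exists_deformation`).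

Near that shape write `5d² - 1 = l + 5w`, with `l` linear and `w` quadratic in the deformation. The
`l` sum to zero, so convexity of `exp` bounds `∑ l²` by a small multiple of `∑ w` plus `200 (∑ w)²`
(`sum_sq_le_of_sum_exp_le`). Rigidity gives `4 ∑ w ≤ ∑ l²` (`linear_parts_rigid`). As `∑ w` is
small, it vanishes (`deformation_eq_zero`). Hence any energy at or below the claimed minimum comes
from an isometric copy of the Fibonacci set, and those copies attain it. -/

/-! ### Horizontal gaps -/

/-- Necessary conditions on the consecutive horizontal gaps `a`, `b` between three points of the
torus whose squared mutual distances are at least `0.1998`; the vertical distances `u`, `v`, `w`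
between three points of a circle of length one have sum at most one. -/
def AdmissibleGaps (a b : ℝ) : Prop :=
  0 ≤ a ∧ 0 ≤ b ∧ ∃ u v w : ℝ, 0 ≤ u ∧ 0 ≤ v ∧ 0 ≤ w ∧ u + v + w ≤ 1 ∧
    0.1998 ≤ a ^ 2 + u ^ 2 ∧ 0.1998 ≤ b ^ 2 + v ^ 2 ∧ 0.1998 ≤ (a + b) ^ 2 + w ^ 2

theorem le_of_sq_add_sq_le {a u A c r : ℝ} (ha : 0 ≤ a) (hu : 0 ≤ u) (haA : a ≤ A)
    (hA : A ^ 2 + c ^ 2 ≤ r) (h : r ≤ a ^ 2 + u ^ 2) : c ≤ u := by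
  have h1 : a ^ 2 ≤ A ^ 2 := pow_le_pow_left₀ ha haA 2
  exact le_of_sq_le_sq (by linarith) hu

namespace AdmissibleGaps

theorem symm {a b : ℝ} (h : AdmissibleGaps a b) : AdmissibleGaps b a := by
  obtain ⟨ha, hb, u, v, w, hu, hv, hw, h1, h2, h3, h4⟩ := h
  exact ⟨hb, ha, v, u, w, hv, hu, hw, by linarith, h3, h2, by rwa [add_comm b a]⟩

/-- Excludes the box `a ≤ A`, `b ≤ B`: there the three vertical distances would be at least `c₁`,
`c₂`, `c₃`, whose sum exceeds one. -/
theorem lt_or_lt {a b : ℝ} (h : AdmissibleGaps a b) (A B c₁ c₂ c₃ : ℝ)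
    (h₁ : A ^ 2 + c₁ ^ 2 ≤ 0.1998 := by norm_num)
    (h₂ : B ^ 2 + c₂ ^ 2 ≤ 0.1998 := by norm_num)
    (h₃ : (A + B) ^ 2 + c₃ ^ 2 ≤ 0.1998 := by norm_num)
    (hc : 1 < c₁ + c₂ + c₃ := by norm_num) : A < a ∨ B < b := by
  obtain ⟨ha, hb, u, v, w, hu, hv, hw, hs, k1, k2, k3⟩ := h
  by_contra! hcon
  have e1 := le_of_sq_add_sq_le ha hu hcon.1 h₁ k1
  have e2 := le_of_sq_add_sq_le hb hv hcon.2 h₂ k2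
  have e3 := le_of_sq_add_sq_le (add_nonneg ha hb) hw (add_le_add hcon.1 hcon.2) h₃ k3
  linarith

/-- A staircase of excluded boxes covers the region below the line. At each step, `b > B` together
with the previous lower bound on `a` already gives the sum; after the last step `a` exceeds half the
target and `a ≤ b` finishes. The next five lemmas repeat this, starting from ever smaller upper
bounds on the gaps. -/
theorem le_add_of_nonneg {a b : ℝ} (h : AdmissibleGaps a b) :
    0.33 ≤ a + b := by
  wlog hab : a ≤ b generalizing a b
  · exact add_comm b a ▸ this h.symm (le_of_not_ge hab)
  have h0 := h.1
  rcases h.lt_or_lt 0.038 0.33 0.4453 0.3014 0.2537 with h1 | h1; swap; · linarith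
  rcases h.lt_or_lt 0.094 0.292 0.4369 0.3384 0.2253 with h2 | h2; swap; · linarith
  rcases h.lt_or_lt 0.1615 0.236 0.4167 0.3796 0.2044 with h3 | h3; swap; · linarith
  rcases h.lt_or_lt 0.2295 0.1685 0.3835 0.414 0.2034 with h4 | h4; swap; · linarith
  linarith

theorem le_add_of_le_0_34 {a b : ℝ} (h : AdmissibleGaps a b) (ha : a ≤ 0.34) (hb : b ≤ 0.34) :
    0.355 ≤ a + b := by
  wlog hab : a ≤ b generalizing a b
  · exact add_comm b a ▸ this h.symm hb ha (le_of_not_ge hab)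
  rcases h.lt_or_lt 0.0205 0.34 0.4465 0.2901 0.2642 with h0 | h0; swap; · linarith
  rcases h.lt_or_lt 0.0305 0.3345 0.4459 0.2964 0.258 with h1 | h1; swap; · linarith
  rcases h.lt_or_lt 0.047 0.3245 0.4445 0.3074 0.2485 with h2 | h2; swap; · linarith
  rcases h.lt_or_lt 0.072 0.308 0.4411 0.3239 0.2353 with h3 | h3; swap; · linarith
  rcases h.lt_or_lt 0.106 0.283 0.4342 0.3459 0.2201 with h4 | h4; swap; · linarith
  rcases h.lt_or_lt 0.147 0.249 0.4221 0.3712 0.2073 with h5 | h5; swap; · linarith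
  rcases h.lt_or_lt 0.191 0.208 0.4041 0.3956 0.2014 with h6 | h6; swap; · linarith
  linarith

theorem le_add_of_le_0_29 {a b : ℝ} (h : AdmissibleGaps a b) (ha : a ≤ 0.29) (hb : b ≤ 0.29) :
    0.375 ≤ a + b := by
  wlog hab : a ≤ b generalizing a b
  · exact add_comm b a ▸ this h.symm hb ha (le_of_not_ge hab)
  rcases h.lt_or_lt 0.0965 0.29 0.4364 0.3401 0.2245 with h0 | h0; swap; · linarith
  rcases h.lt_or_lt 0.1115 0.2785 0.4328 0.3496 0.2184 with h1 | h1; swap; · linarith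
  rcases h.lt_or_lt 0.13 0.2635 0.4276 0.361 0.212 with h2 | h2; swap; · linarith
  rcases h.lt_or_lt 0.1515 0.245 0.4205 0.3738 0.2063 with h3 | h3; swap; · linarith
  rcases h.lt_or_lt 0.175 0.2235 0.4113 0.3871 0.2024 with h4 | h4; swap; · linarith
  rcases h.lt_or_lt 0.199 0.2 0.4002 0.3997 0.2014 with h5 | h5; swap; · linarith
  linarith

theorem le_add_of_le_0_25 {a b : ℝ} (h : AdmissibleGaps a b) (ha : a ≤ 0.25) (hb : b ≤ 0.25) :
    0.385 ≤ a + b := by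
  wlog hab : a ≤ b generalizing a b
  · exact add_comm b a ▸ this h.symm hb ha (le_of_not_ge hab)
  rcases h.lt_or_lt 0.146 0.25 0.4224 0.3705 0.2073 with h0 | h0; swap; · linarith
  rcases h.lt_or_lt 0.158 0.239 0.4181 0.3777 0.2054 with h1 | h1; swap; · linarith
  rcases h.lt_or_lt 0.1715 0.227 0.4127 0.385 0.2024 with h2 | h2; swap; · linarith
  rcases h.lt_or_lt 0.1855 0.2135 0.4066 0.3927 0.2014 with h3 | h3; swap; · linarith
  rcases h.lt_or_lt 0.1995 0.1995 0.3999 0.3999 0.2014 with h4 | h4; swap; · linarith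
  linarith

theorem le_add_of_le_0_23 {a b : ℝ} (h : AdmissibleGaps a b) (ha : a ≤ 0.23) (hb : b ≤ 0.23) :
    0.3895 ≤ a + b := by
  wlog hab : a ≤ b generalizing a b
  · exact add_comm b a ▸ this h.symm hb ha (le_of_not_ge hab)
  rcases h.lt_or_lt 0.168 0.23 0.4142 0.3832 0.2034 with h0 | h0; swap; · linarith
  rcases h.lt_or_lt 0.177 0.2215 0.4104 0.3882 0.2024 with h1 | h1; swap; · linarith
  rcases h.lt_or_lt 0.1865 0.2125 0.4062 0.3932 0.2014 with h2 | h2; swap; · linarith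
  rcases h.lt_or_lt 0.196 0.203 0.4017 0.3982 0.2014 with h3 | h3; swap; · linarith
  linarith

theorem le_add_of_le_0_221 {a b : ℝ} (h : AdmissibleGaps a b) (ha : a ≤ 0.221) (hb : b ≤ 0.221) :
    0.392 ≤ a + b := by
  wlog hab : a ≤ b generalizing a b
  · exact add_comm b a ▸ this h.symm hb ha (le_of_not_ge hab)
  rcases h.lt_or_lt 0.1775 0.221 0.4102 0.3885 0.2024 with h0 | h0; swap; · linarith
  rcases h.lt_or_lt 0.1845 0.2145 0.4071 0.3921 0.2014 with h1 | h1; swap; · linarith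
  rcases h.lt_or_lt 0.1915 0.2075 0.4038 0.3959 0.2014 with h2 | h2; swap; · linarith
  rcases h.lt_or_lt 0.1985 0.2005 0.4004 0.3994 0.2014 with h3 | h3; swap; · linarith
  linarith

end AdmissibleGaps

theorem sum_fin_five_cyclic {M : Type*} [AddCommMonoid M] (a : Fin 5 → M) (i : Fin 5) :
    ∑ j, a j = a i + a (i + 1) + a (i + 2) + a (i + 3) + a (i + 4) := by
  rw [← Equiv.sum_comp (Equiv.addLeft i) a]
  simp [Fin.sum_univ_five]

/-- The other four gaps split into two consecutive pairs. -/
theorem le_of_forall_le_add {a : Fin 5 → ℝ} (ha : ∑ i, a i = 1) {m : ℝ}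
    (h : ∀ i, m ≤ a i + a (i + 1)) (i : Fin 5) : a i ≤ 1 - 2 * m := by
  have h1 := h (i + 1)
  have h2 := h (i + 3)
  rw [add_assoc, show (1 + 1 : Fin 5) = 2 from rfl] at h1
  rw [add_assoc, show (3 + 1 : Fin 5) = 4 from rfl] at h2
  linarith [sum_fin_five_cyclic a i]

/-- Five cyclic gaps with total length one, consecutive ones being admissible, are close to `1/5`. -/
theorem gap_bounds {a : Fin 5 → ℝ} (ha : ∑ i, a i = 1)
    (h : ∀ i, AdmissibleGaps (a i) (a (i + 1))) :
    (∀ i, 0.183 ≤ a i ∧ a i ≤ 0.216) ∧ ∀ i, 0.392 ≤ a i + a (i + 1) := by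
  -- Bootstrap: a lower bound `m` on consecutive sums gives the upper bound `1 - 2m` on each gap,
  -- which in turn improves `m`.
  have u₁ : ∀ i, a i ≤ 0.34 := fun i ↦
    (le_of_forall_le_add ha (fun j ↦ (h j).le_add_of_nonneg) i).trans (by norm_num)
  have u₂ : ∀ i, a i ≤ 0.29 := fun i ↦
    (le_of_forall_le_add ha (fun j ↦ (h j).le_add_of_le_0_34 (u₁ _) (u₁ _)) i).trans (by norm_num)
  have u₃ : ∀ i, a i ≤ 0.25 := fun i ↦
    (le_of_forall_le_add ha (fun j ↦ (h j).le_add_of_le_0_29 (u₂ _) (u₂ _)) i).trans (by norm_num)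
  have u₄ : ∀ i, a i ≤ 0.23 := fun i ↦
    (le_of_forall_le_add ha (fun j ↦ (h j).le_add_of_le_0_25 (u₃ _) (u₃ _)) i).trans (by norm_num)
  have u₅ : ∀ i, a i ≤ 0.221 := fun i ↦
    (le_of_forall_le_add ha (fun j ↦ (h j).le_add_of_le_0_23 (u₄ _) (u₄ _)) i).trans (by norm_num)
  have hm : ∀ i, 0.392 ≤ a i + a (i + 1) := fun i ↦ (h i).le_add_of_le_0_221 (u₅ _) (u₅ _)
  have u₆ : ∀ i, a i ≤ 0.216 := fun i ↦ (le_of_forall_le_add ha hm i).trans (by norm_num)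
  refine ⟨fun i ↦ ⟨?_, u₆ i⟩, hm⟩
  rcases (h i).lt_or_lt 0.183 0.216 0.4078 0.3913 0.2014 with h1 | h1
  · exact h1.le
  · exact absurd (u₆ _) h1.not_ge

/-! ### Local rigidity -/

theorem one_add_add_sq_le_exp_neg (q t : ℝ) (hq : 0 ≤ q) :
    1 - q * t + q ^ 2 / 2 * max (-t) 0 ^ 2 ≤ Real.exp (-(q * t)) := by
  rcases le_total t 0 with ht | ht
  · rw [max_eq_left (by linarith)]
    have := Real.quadratic_le_exp_of_nonneg (x := -(q * t)) (by nlinarith)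
    nlinarith
  · rw [max_eq_right (by linarith)]
    have := Real.add_one_le_exp (-(q * t))
    linarith

/-- If `t = l + 5 w` with `w ≥ 0` and `∑ l = 0`, and if an exponential sum in `t` is at most the
number of its terms, then `∑ l²` is controlled by `∑ w`. -/
theorem sum_sq_le_of_sum_exp_le {ι : Type*} (s : Finset ι) (l w : ι → ℝ) (hw : ∀ i ∈ s, 0 ≤ w i)
    (hl : ∑ i ∈ s, l i = 0) {q : ℝ} (hq : 0 < q)
    (h : ∑ i ∈ s, Real.exp (-(q * (l i + 5 * w i))) ≤ s.card) :
    ∑ i ∈ s, l i ^ 2 ≤ 80 * s.card / q * ∑ i ∈ s, w i + 200 * (∑ i ∈ s, w i) ^ 2 := by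
  set S := ∑ i ∈ s, w i with hS
  set n : ι → ℝ := fun i ↦ max (-(l i + 5 * w i)) 0 with hn
  have h1 : ∑ i ∈ s, n i ^ 2 ≤ 10 * S / q := by
    have := (Finset.sum_le_sum fun i _ ↦
      one_add_add_sq_le_exp_neg q (l i + 5 * w i) hq.le).trans h
    simp only [Finset.sum_add_distrib, Finset.sum_sub_distrib, ← Finset.mul_sum, hl, ← hS,
      Finset.sum_const, nsmul_eq_mul, mul_one] at this
    rw [le_div_iff₀ hq]
    have h2 : q * (q * ∑ i ∈ s, n i ^ 2) ≤ q * (10 * S) := by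
      simp only [hn]; nlinarith
    linarith [le_of_mul_le_mul_left h2 hq]
  have h2 : (∑ i ∈ s, n i) ^ 2 ≤ s.card * ∑ i ∈ s, n i ^ 2 := sq_sum_le_card_mul_sum_sq
  have h3 : ∑ i ∈ s, |l i| ≤ 2 * (∑ i ∈ s, n i + 5 * S) := by
    have : ∀ i ∈ s, |l i| ≤ l i + 2 * (n i + 5 * w i) := by
      intro i hi
      have hw' := hw i hi
      have e1 : -(l i + 5 * w i) ≤ n i := le_max_left _ _
      have e2 : 0 ≤ n i := le_max_right _ _
      rw [abs_le]; constructor <;> linarith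
    refine (Finset.sum_le_sum this).trans_eq ?_
    simp only [Finset.sum_add_distrib, ← Finset.mul_sum, hl, ← hS]
    ring
  have h4 : ∑ i ∈ s, l i ^ 2 ≤ (∑ i ∈ s, |l i|) ^ 2 := by
    simpa only [sq_abs] using Finset.sum_sq_le_sq_sum_of_nonneg fun i _ ↦ abs_nonneg (l i)
  have h5 : 0 ≤ ∑ i ∈ s, |l i| := Finset.sum_nonneg fun i _ ↦ abs_nonneg _
  have h6 : (∑ i ∈ s, |l i|) ^ 2 ≤ (2 * (∑ i ∈ s, n i + 5 * S)) ^ 2 := pow_le_pow_left₀ h5 h3 2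
  have h7 : (s.card : ℝ) * ∑ i ∈ s, n i ^ 2 ≤ s.card * (10 * S / q) := by gcongr
  have h8 : 80 * s.card / q * S = 8 * (s.card * (10 * S / q)) := by ring
  -- The square supplies `(N + 5S)² ≤ 2N² + 50S²`, where `N = ∑ n`.
  nlinarith [sq_nonneg (∑ i ∈ s, n i - 5 * S)]

/-- The `μ` part is `(s + t)² ≤ 2s² + 2t²`. For the `ν` part, the zero sum makes each `ν i` minus
the sum of two disjoint consecutive pairs. -/
theorem sum_sq_add_sq_cyclic_le (μ ν : Fin 5 → ℝ) (hν : ∑ i, ν i = 0) :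
    ∑ i, (ν i ^ 2 + (μ i + μ (i + 1)) ^ 2) ≤ 4 * ∑ i, (μ i ^ 2 + (ν i + ν (i + 1)) ^ 2) := by
  have shift (f : Fin 5 → ℝ) (k : Fin 5) : ∑ i, f (i + k) = ∑ i, f i :=
    Equiv.sum_comp (Equiv.addRight k) f
  have h1 : ∑ i, (μ i + μ (i + 1)) ^ 2 ≤ 4 * ∑ i, μ i ^ 2 := by
    have : ∀ i, (μ i + μ (i + 1)) ^ 2 ≤ 2 * μ i ^ 2 + 2 * μ (i + 1) ^ 2 := fun i ↦ by
      linarith [sq_nonneg (μ i - μ (i + 1))]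
    refine (Finset.sum_le_sum fun i _ ↦ this i).trans_eq ?_
    rw [Finset.sum_add_distrib, ← Finset.mul_sum, ← Finset.mul_sum, shift (fun i ↦ μ i ^ 2)]
    ring
  have h2 : ∑ i, ν i ^ 2 ≤ 4 * ∑ i, (ν i + ν (i + 1)) ^ 2 := by
    have : ∀ i, ν i ^ 2 ≤ 2 * (ν (i + 1) + ν (i + 1 + 1)) ^ 2 +
        2 * (ν (i + 3) + ν (i + 3 + 1)) ^ 2 := fun i ↦ by
      have e := sum_fin_five_cyclic ν i
      rw [add_assoc i 1 1, add_assoc i 3 1, show (1 + 1 : Fin 5) = 2 from rfl,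
        show (3 + 1 : Fin 5) = 4 from rfl, show ν i = -((ν (i + 1) + ν (i + 2)) +
          (ν (i + 3) + ν (i + 4))) by linarith]
      linarith [sq_nonneg ((ν (i + 1) + ν (i + 2)) - (ν (i + 3) + ν (i + 4)))]
    refine (Finset.sum_le_sum fun i _ ↦ this i).trans_eq ?_
    rw [Finset.sum_add_distrib, ← Finset.mul_sum, ← Finset.mul_sum,
      shift (fun i ↦ (ν i + ν (i + 1)) ^ 2), shift (fun i ↦ (ν i + ν (i + 1)) ^ 2)]
    ring
  rw [Finset.sum_add_distrib, Finset.sum_add_distrib]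
  linarith

/-- Rigidity of the Fibonacci configuration: the linear parts of the changes of the squared
distances control the relative displacements. -/
theorem linear_parts_rigid (α β : Fin 5 → ℝ) (hα : ∑ i, α i = 0) (hβ : ∑ i, β i = 0) :
    4 * ∑ i, (α i ^ 2 + β i ^ 2 + (α i + α (i + 1)) ^ 2 + (β i + β (i + 1)) ^ 2) ≤
      ∑ i, ((2 * α i + 4 * β i) ^ 2 +
        (4 * (α i + α (i + 1)) - 2 * (β i + β (i + 1))) ^ 2) := by
  -- Coordinates along the orthogonal vectors `(1, 2)` and `(2, -1)`: the linear parts become `2μ i`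
  -- and `2(ν i + ν (i + 1))`, and `μ² + ν² = 5(α² + β²)`.
  have h := sum_sq_add_sq_cyclic_le (fun i ↦ α i + 2 * β i) (fun i ↦ 2 * α i - β i)
    (by rw [Finset.sum_sub_distrib, ← Finset.mul_sum, hα, hβ]; ring)
  rw [Finset.mul_sum] at h ⊢
  refine sub_nonneg.1 (le_of_le_of_eq (mul_nonneg (by norm_num : (0 : ℝ) ≤ 4 / 5) (sub_nonneg.2 h)) ?_)
  rw [← Finset.sum_sub_distrib, ← Finset.sum_sub_distrib, Finset.mul_sum]
  exact Finset.sum_congr rfl fun i _ ↦ by ring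

theorem sum_linear_parts (α β : Fin 5 → ℝ) (hα : ∑ i, α i = 0) :
    ∑ i, ((2 * α i + 4 * β i) + (4 * (α i + α (i + 1)) - 2 * (β i + β (i + 1)))) = 0 := by
  simp only [Fin.sum_univ_five] at *
  simp only [Fin.isValue, Fin.reduceAdd, zero_add]
  linarith

/-- Local optimality: a small deformation of the Fibonacci configuration, given by its cyclic
increments `1 / 5 + α i` and `2 / 5 + β i`, is trivial if it does not increase the energy. -/
theorem deformation_eq_zero {α β : Fin 5 → ℝ} (hα : ∑ i, α i = 0) (hβ : ∑ i, β i = 0)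
    (hα₁ : ∀ i, |α i| ≤ 0.017) (hα₂ : ∀ i, |α i + α (i + 1)| ≤ 0.025)
    (hβ₁ : ∀ i, |β i| ≤ 0.035) (hβ₂ : ∀ i, |β i + β (i + 1)| ≤ 0.027) {q : ℝ} (hq : 10000 ≤ q)
    (h : ∑ i, (Real.exp (-(q * (5 * ((1 / 5 + α i) ^ 2 + (2 / 5 + β i) ^ 2) - 1))) +
      Real.exp (-(q * (5 * ((2 / 5 + (α i + α (i + 1))) ^ 2 +
        (-1 / 5 + (β i + β (i + 1))) ^ 2) - 1)))) ≤ 10) :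
    α = 0 ∧ β = 0 := by
  let l : Fin 5 ⊕ Fin 5 → ℝ := Sum.elim (fun i ↦ 2 * α i + 4 * β i)
    (fun i ↦ 4 * (α i + α (i + 1)) - 2 * (β i + β (i + 1)))
  let w : Fin 5 ⊕ Fin 5 → ℝ := Sum.elim (fun i ↦ α i ^ 2 + β i ^ 2)
    (fun i ↦ (α i + α (i + 1)) ^ 2 + (β i + β (i + 1)) ^ 2)
  have hw : ∀ k, 0 ≤ w k := by
    rintro (i | i) <;> simp only [w, Sum.elim_inl, Sum.elim_inr] <;> positivity
  have hl : ∑ k, l k = 0 := by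
    rw [Fintype.sum_sum_type, ← Finset.sum_add_distrib]
    exact sum_linear_parts α β hα
  have hw' : ∑ k, w k =
      ∑ i, (α i ^ 2 + β i ^ 2 + (α i + α (i + 1)) ^ 2 + (β i + β (i + 1)) ^ 2) := by
    rw [Fintype.sum_sum_type, ← Finset.sum_add_distrib]
    exact Finset.sum_congr rfl fun i _ ↦ by simp only [w, Sum.elim_inl, Sum.elim_inr]; ring
  have hrig : 4 * ∑ k, w k ≤ ∑ k, l k ^ 2 := by
    rw [hw', Fintype.sum_sum_type, ← Finset.sum_add_distrib]
    exact linear_parts_rigid α β hα hβ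
  have hq0 : 0 < q := by linarith
  have key := sum_sq_le_of_sum_exp_le Finset.univ l w (fun k _ ↦ hw k) hl hq0 (by
    rw [Fintype.sum_sum_type, ← Finset.sum_add_distrib]
    refine le_of_eq_of_le (Finset.sum_congr rfl fun i _ ↦ ?_) (h.trans (by simp))
    simp only [l, w, Sum.elim_inl, Sum.elim_inr]
    congr 3 <;> ring)
  have hS : ∑ k, w k ≤ 0.0195 := by
    rw [hw']
    have : ∀ i ∈ Finset.univ, α i ^ 2 + β i ^ 2 + (α i + α (i + 1)) ^ 2 + (β i + β (i + 1)) ^ 2 ≤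
        0.017 ^ 2 + 0.035 ^ 2 + 0.025 ^ 2 + 0.027 ^ 2 := fun i _ ↦ by
      have := sq_le_sq' (abs_le.1 (hα₁ i)).1 (abs_le.1 (hα₁ i)).2
      have := sq_le_sq' (abs_le.1 (hα₂ i)).1 (abs_le.1 (hα₂ i)).2
      have := sq_le_sq' (abs_le.1 (hβ₁ i)).1 (abs_le.1 (hβ₁ i)).2
      have := sq_le_sq' (abs_le.1 (hβ₂ i)).1 (abs_le.1 (hβ₂ i)).2
      linarith
    refine (Finset.sum_le_sum this).trans ?_
    norm_num
  have hS0 : 0 ≤ ∑ k, w k := Finset.sum_nonneg fun k _ ↦ hw k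
  have hc : (80 * (Finset.univ : Finset (Fin 5 ⊕ Fin 5)).card / q : ℝ) ≤ 0.08 := by
    rw [div_le_iff₀ hq0]; simp; linarith
  -- With `S = ∑ w`, `4S ≤ 0.08 S + 200 S²`, while `200 S ≤ 3.9`; since `3.98 < 4`, `S = 0`.
  have hS' : ∑ k, w k = 0 := by
    have := mul_le_mul_of_nonneg_right hc hS0
    nlinarith
  rw [Finset.sum_eq_zero_iff_of_nonneg fun k _ ↦ hw k] at hS'
  have h0 : ∀ i, α i ^ 2 + β i ^ 2 = 0 := fun i ↦ hS' (Sum.inl i) (Finset.mem_univ _)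
  constructor <;> ext i <;> simp only [Pi.zero_apply] <;> nlinarith [h0 i]

/-! ### From distance bounds to a small deformation -/

namespace UnitAddCircle

theorem norm_coe_le_abs (t : ℝ) : ‖(t : UnitAddCircle)‖ ≤ |t| := by
  rw [UnitAddCircle.norm_eq]
  simpa using round_le t 0

theorem norm_sq_le_of_coe_eq {c : UnitAddCircle} {t : ℝ} (h : (t : UnitAddCircle) = c) :
    ‖c‖ ^ 2 ≤ t ^ 2 := by
  rw [← h, ← sq_abs t]
  exact pow_le_pow_left₀ (norm_nonneg _) (norm_coe_le_abs t) 2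

theorem exists_coe_eq_and_abs_eq_norm (c : UnitAddCircle) :
    ∃ t : ℝ, (t : UnitAddCircle) = c ∧ |t| = ‖c‖ := by
  induction c using QuotientAddGroup.induction_on with
  | H z =>
    refine ⟨z - round z, ?_, UnitAddCircle.norm_eq.symm⟩
    rw [AddCircle.coe_sub, sub_eq_self]
    exact (AddCircle.coe_eq_zero_iff 1).2 ⟨round z, by simp⟩

theorem norm_le_half (c : UnitAddCircle) : ‖c‖ ≤ 1 / 2 := by
  simpa using AddCircle.norm_le_half_period 1 (x := c) one_ne_zero

/-- The perimeter of a triangle on a circle of length one is at most one. -/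
theorem norm_add_norm_add_norm_add_le (s t : UnitAddCircle) : ‖s‖ + ‖t‖ + ‖s + t‖ ≤ 1 := by
  obtain ⟨a, rfl, ha⟩ := exists_coe_eq_and_abs_eq_norm s
  obtain ⟨b, rfl, hb⟩ := exists_coe_eq_and_abs_eq_norm t
  have ha' := norm_le_half a
  have hb' := norm_le_half b
  rw [← ha] at ha' ⊢
  rw [← hb] at hb' ⊢
  have h (n : ℤ) : ‖(a + b : UnitAddCircle)‖ ≤ |a + b - n| := by
    rw [← AddCircle.coe_add, UnitAddCircle.norm_eq]
    exact round_le _ _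
  have h0 := h 0
  have h1 := h 1
  have h2 := h (-1)
  push_cast at h0 h1 h2
  rcases abs_cases a with ⟨e1, _⟩ | ⟨e1, _⟩ <;> rcases abs_cases b with ⟨e2, _⟩ | ⟨e2, _⟩ <;>
    rcases abs_cases (a + b - 0) with ⟨e3, _⟩ | ⟨e3, _⟩ <;>
    rcases abs_cases (a + b - 1) with ⟨e4, _⟩ | ⟨e4, _⟩ <;>
    rcases abs_cases (a + b - -1) with ⟨e5, _⟩ | ⟨e5, _⟩ <;> linarith

end UnitAddCircle

theorem sum_sub_cyclic {M : Type*} [AddCommGroup M] (y : Fin 5 → M) :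
    ∑ i, (y (i + 1) - y i) = 0 := by
  rw [Finset.sum_sub_distrib, sub_eq_zero]
  exact Equiv.sum_comp (Equiv.addRight 1) y

theorem forall_fin_five_of_cyclic {P : Fin 5 → Prop} (h0 : P 0) (h : ∀ i, P i → P (i + 1))
    (i : Fin 5) : P i := by
  have h1 := h 0 h0
  have h2 := h _ h1
  have h3 := h _ h2
  have h4 := h _ h3
  fin_cases i <;> assumption

section Configuration

variable {x y : Fin 5 → UnitAddCircle} {a : Fin 5 → ℝ}

theorem admissibleGaps_of_sq_le (ha : ∀ i, 0 ≤ a i)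
    (hax : ∀ i, (a i : UnitAddCircle) = x (i + 1) - x i)
    (hd : ∀ i j, i ≠ j → 0.1998 ≤ ‖x j - x i‖ ^ 2 + ‖y j - y i‖ ^ 2) (i : Fin 5) :
    AdmissibleGaps (a i) (a (i + 1)) := by
  have key (i j : Fin 5) (hij : i ≠ j) (t : ℝ) (h : (t : UnitAddCircle) = x j - x i) :
      0.1998 ≤ t ^ 2 + ‖y j - y i‖ ^ 2 :=
    (hd i j hij).trans (by linarith [UnitAddCircle.norm_sq_le_of_coe_eq h])
  have hne : i ≠ i + 1 ∧ i + 1 ≠ i + 1 + 1 ∧ i ≠ i + 1 + 1 := by revert i; decide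
  refine ⟨ha _, ha _, ‖y (i + 1) - y i‖, ‖y (i + 1 + 1) - y (i + 1)‖, ‖y (i + 1 + 1) - y i‖,
    norm_nonneg _, norm_nonneg _, norm_nonneg _, ?_, key _ _ hne.1 _ (hax _),
    key _ _ hne.2.1 _ (hax _), key _ _ hne.2.2 _ ?_⟩
  · simpa using UnitAddCircle.norm_add_norm_add_norm_add_le (y (i + 1) - y i)
      (y (i + 1 + 1) - y (i + 1))
  · rw [AddCircle.coe_add, hax, hax]; abel

/-- Five points of the torus, sorted by their first coordinate, whose squared mutual distances are
at least `0.1998` form a small deformation of the Fibonacci configuration or of its mirror image. -/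
theorem exists_deformation (ha : ∀ i, 0 ≤ a i) (hsum : ∑ i, a i = 1)
    (hax : ∀ i, (a i : UnitAddCircle) = x (i + 1) - x i)
    (hd : ∀ i j, i ≠ j → 0.1998 ≤ ‖x j - x i‖ ^ 2 + ‖y j - y i‖ ^ 2) :
    (∀ i, |a i - 1 / 5| ≤ 0.017) ∧ (∀ i, |a i - 1 / 5 + (a (i + 1) - 1 / 5)| ≤ 0.025) ∧
    ∃ (ε : ℝ) (β : Fin 5 → ℝ), (ε = 1 ∨ ε = -1) ∧ ∑ i, β i = 0 ∧
      (∀ i, ((ε * (2 / 5 + β i) : ℝ) : UnitAddCircle) = y (i + 1) - y i) ∧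
      (∀ i, |β i| ≤ 0.035) ∧ ∀ i, |β i + β (i + 1)| ≤ 0.027 := by
  have hadm := admissibleGaps_of_sq_le ha hax hd
  obtain ⟨hb, hm⟩ := gap_bounds hsum hadm
  have hM (i : Fin 5) : a i + a (i + 1) ≤ 0.425 := by
    have h1 := hm (i + 2)
    rw [add_assoc i 2 1, show (2 + 1 : Fin 5) = 3 from rfl] at h1
    linarith [sum_fin_five_cyclic a i, (hb (i + 4)).1]
  refine ⟨fun i ↦ ?_, fun i ↦ ?_, ?_⟩
  · rw [abs_le]; constructor <;> linarith [(hb i).1, (hb i).2]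
  · rw [abs_le]; constructor <;> linarith [hm i, hM i]
  choose e he hen using fun i ↦ UnitAddCircle.exists_coe_eq_and_abs_eq_norm (y (i + 1) - y i)
  have key (i j : Fin 5) (hij : i ≠ j) (t A c : ℝ) (h : (t : UnitAddCircle) = x j - x i)
      (ht : 0 ≤ t) (htA : t ≤ A) (hA : A ^ 2 + c ^ 2 ≤ 0.1998) : c ≤ ‖y j - y i‖ := by
    refine le_of_sq_add_sq_le ht (norm_nonneg _) htA hA ((hd i j hij).trans ?_)
    linarith [UnitAddCircle.norm_sq_le_of_coe_eq h]
  have hY (i : Fin 5) : 0.3913 ≤ |e i| := by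
    rw [hen]
    exact key _ _ (by revert i; decide) _ 0.216 _ (hax i) (ha i) (hb i).2 (by norm_num)
  have hY' (i : Fin 5) : |e i| ≤ 1 / 2 := by
    rw [hen]; exact UnitAddCircle.norm_le_half _
  have hZ (i : Fin 5) : 0.138 ≤ |e i + e (i + 1)| := by
    have h1 := key i (i + 1 + 1) (by revert i; decide) (a i + a (i + 1)) 0.425 0.138
      (by rw [AddCircle.coe_add, hax, hax]; abel) (add_nonneg (ha _) (ha _)) (hM i) (by norm_num)
    refine h1.trans (le_of_eq_of_le ?_ (UnitAddCircle.norm_coe_le_abs _))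
    rw [AddCircle.coe_add, he, he]
    exact congrArg norm (by abel)
  -- Neighbouring vertical steps of opposite sign would nearly cancel, to at most `0.5 - 0.3913 <
  -- 0.138`, against `hZ`.
  have hsign : ∃ ε : ℝ, (ε = 1 ∨ ε = -1) ∧ ∀ i, e i = ε * |e i| := by
    rcases abs_cases (e 0) with h0 | h0
    · refine ⟨1, .inl rfl, forall_fin_five_of_cyclic (by linarith) fun i hi ↦ ?_⟩
      have h1 := hY i; have h2 := hY (i + 1); have h3 := hY' i; have h4 := hY' (i + 1)
      have h5 := hZ i
      rcases abs_cases (e (i + 1)) with h | h <;>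
        rcases abs_cases (e i + e (i + 1)) with h' | h' <;> linarith
    · refine ⟨-1, .inr rfl, forall_fin_five_of_cyclic (by linarith) fun i hi ↦ ?_⟩
      have h1 := hY i; have h2 := hY (i + 1); have h3 := hY' i; have h4 := hY' (i + 1)
      have h5 := hZ i
      rcases abs_cases (e (i + 1)) with h | h <;>
        rcases abs_cases (e i + e (i + 1)) with h' | h' <;> linarith
  obtain ⟨ε, hε, hεe⟩ := hsign
  -- The steps close up on the circle, so this sum is an integer; it lies between `5 · 0.3913` and
  -- `5/2`.
  have hsum2 : ∑ i, |e i| = 2 := by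
    have h1 : ((∑ i, e i : ℝ) : UnitAddCircle) = 0 := by
      rw [← sum_sub_cyclic y, ← Finset.sum_congr rfl fun i _ ↦ he i]
      exact map_sum (QuotientAddGroup.mk' (AddSubgroup.zmultiples (1 : ℝ))) e _
    obtain ⟨n, hn⟩ := (AddCircle.coe_eq_zero_iff 1).1 h1
    rw [Finset.sum_congr rfl fun i _ ↦ hεe i, ← Finset.mul_sum, zsmul_eq_mul, mul_one] at hn
    have h2 : ∃ m : ℤ, ∑ i, |e i| = m := by
      rcases hε with rfl | rfl
      · exact ⟨n, by linarith⟩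
      · exact ⟨-n, by push_cast; linarith⟩
    obtain ⟨m, h2⟩ := h2
    have h3 : (5 : ℝ) * 0.3913 ≤ m := by
      simpa [← h2] using Finset.card_nsmul_le_sum Finset.univ (fun i ↦ |e i|) _ fun i _ ↦ hY i
    have h4 : (m : ℝ) ≤ 5 * (1 / 2) := by
      simpa [← h2] using Finset.sum_le_card_nsmul Finset.univ (fun i ↦ |e i|) _ fun i _ ↦ hY' i
    have h5 : (1 : ℤ) < m := by exact_mod_cast (by linarith : (1 : ℝ) < m)
    have h6 : m < (3 : ℤ) := by exact_mod_cast (by linarith : (m : ℝ) < 3)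
    rw [h2, show m = 2 by omega]; norm_num
  refine ⟨ε, fun i ↦ |e i| - 2 / 5, hε, ?_, fun i ↦ ?_, fun i ↦ ?_, fun i ↦ ?_⟩
  · rw [Finset.sum_sub_distrib, hsum2]; norm_num
  · rw [add_sub_cancel, ← hεe, he]
  all_goals
    have h0 := sum_fin_five_cyclic (fun i ↦ |e i|) i
    rw [hsum2] at h0
    rw [abs_le]
    constructor <;> linarith [hY i, hY (i + 1), hY (i + 2), hY (i + 3), hY (i + 4)]

end Configuration

/-- Increments of a sorted configuration whose exponential energy is at most ten. -/
theorem increments_eq_of_sum_exp_le {x y : Fin 5 → UnitAddCircle} {a : Fin 5 → ℝ}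
    (ha : ∀ i, 0 ≤ a i) (hsum : ∑ i, a i = 1)
    (hax : ∀ i, (a i : UnitAddCircle) = x (i + 1) - x i) {q : ℝ} (hq : 10000 ≤ q)
    (h : ∑ i, (Real.exp (q * (1 - 5 * (‖x (i + 1) - x i‖ ^ 2 + ‖y (i + 1) - y i‖ ^ 2))) +
      Real.exp (q * (1 - 5 * (‖x (i + 2) - x i‖ ^ 2 + ‖y (i + 2) - y i‖ ^ 2)))) ≤ 10) :
    ∃ ε : ℝ, (ε = 1 ∨ ε = -1) ∧ ∀ i, x (i + 1) - x i = ((1 / 5 : ℝ) : UnitAddCircle) ∧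
      y (i + 1) - y i = ((ε * (2 / 5) : ℝ) : UnitAddCircle) := by
  -- `1 + q(1 - 5s) ≤ 10` gives `5s ≥ 1 - 9/q`, at least `0.9991` for `q ≥ 10000`.
  have hfar {s : ℝ} (hs : Real.exp (q * (1 - 5 * s)) ≤ 10) : 0.1998 ≤ s := by
    have := (Real.add_one_le_exp _).trans hs
    nlinarith
  have hterm (i : Fin 5) := (Finset.single_le_sum (fun i _ ↦ by positivity)
    (Finset.mem_univ i)).trans h
  have hd₁ (i : Fin 5) : 0.1998 ≤ ‖x (i + 1) - x i‖ ^ 2 + ‖y (i + 1) - y i‖ ^ 2 :=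
    hfar ((le_add_of_nonneg_right (Real.exp_nonneg _)).trans (hterm i))
  have hd₂ (i : Fin 5) : 0.1998 ≤ ‖x (i + 2) - x i‖ ^ 2 + ‖y (i + 2) - y i‖ ^ 2 :=
    hfar ((le_add_of_nonneg_left (Real.exp_nonneg _)).trans (hterm i))
  have hd (i j : Fin 5) (hij : i ≠ j) : 0.1998 ≤ ‖x j - x i‖ ^ 2 + ‖y j - y i‖ ^ 2 := by
    have : (j = i + 1 ∨ j = i + 2) ∨ (i = j + 1 ∨ i = j + 2) := by revert i j; decide
    rcases this with (rfl | rfl) | (rfl | rfl)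
    · exact hd₁ _
    · exact hd₂ _
    · rw [norm_sub_rev, norm_sub_rev (y j)]; exact hd₁ _
    · rw [norm_sub_rev, norm_sub_rev (y j)]; exact hd₂ _
  obtain ⟨hα₁, hα₂, ε, β, hε, hβ, hyβ, hβ₁, hβ₂⟩ := exists_deformation ha hsum hax hd
  have hεsq : ε ^ 2 = 1 := by rcases hε with rfl | rfl <;> norm_num
  have hε0 : (ε : UnitAddCircle) = 0 := by
    rcases hε with rfl | rfl
    · exact AddCircle.coe_period 1
    · rw [AddCircle.coe_neg, neg_eq_zero]; exact AddCircle.coe_period 1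
  have htwo (i : Fin 5) : i + 2 = i + 1 + 1 := by rw [add_assoc]; rfl
  obtain ⟨hα0, hβ0⟩ := deformation_eq_zero (α := fun i ↦ a i - 1 / 5) (β := β)
    (by rw [Finset.sum_sub_distrib, hsum]; norm_num) hβ hα₁ hα₂ hβ₁ hβ₂ hq (by
      refine (Finset.sum_le_sum fun i _ ↦ add_le_add ?_ ?_).trans h <;>
        rw [Real.exp_le_exp, ← mul_neg, neg_sub]
      · have h1 := UnitAddCircle.norm_sq_le_of_coe_eq (hax i)
        have h2 := UnitAddCircle.norm_sq_le_of_coe_eq (hyβ i)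
        rw [mul_pow, hεsq] at h2
        refine mul_le_mul_of_nonneg_left ?_ (by linarith)
        rw [add_sub_cancel]
        linarith
      · have h1 : ‖x (i + 2) - x i‖ ^ 2 ≤ (a i + a (i + 1)) ^ 2 :=
          UnitAddCircle.norm_sq_le_of_coe_eq (by
            rw [AddCircle.coe_add, hax, hax, htwo]; abel)
        -- Two vertical steps of `2/5` amount to `4/5`, represented by `-1/5` modulo one; hence the
        -- subtracted `ε`.
        have h2 : ‖y (i + 2) - y i‖ ^ 2 ≤ (ε * (-1 / 5 + (β i + β (i + 1)))) ^ 2 :=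
          UnitAddCircle.norm_sq_le_of_coe_eq (by
            rw [show ε * (-1 / 5 + (β i + β (i + 1))) =
              ε * (2 / 5 + β i) + ε * (2 / 5 + β (i + 1)) - ε by ring, AddCircle.coe_sub,
              AddCircle.coe_add, hyβ, hyβ, hε0, htwo]; abel)
        rw [mul_pow, hεsq] at h2
        refine mul_le_mul_of_nonneg_left ?_ (by linarith)
        rw [show 2 / 5 + (a i - 1 / 5 + (a (i + 1) - 1 / 5)) = a i + a (i + 1) by ring]
        linarith)
  refine ⟨ε, hε, fun i ↦ ⟨?_, ?_⟩⟩
  · rw [← hax, show a i = 1 / 5 by simpa [sub_eq_zero] using congrFun hα0 i]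
  · rw [← hyβ, hβ0, Pi.zero_apply, add_zero]

/-! ### From the Riesz energy to a Gaussian sum -/

theorem ofReal_exp_le_one_div_rpow {d p : ℝ} (hd : 0 ≤ d) (hp : 0 < p) :
    ENNReal.ofReal (5 ^ (p / 2) * Real.exp (p / 2 * (1 - 5 * d ^ 2))) ≤
      1 / ENNReal.ofReal d ^ p := by
  rcases hd.eq_or_lt with rfl | hd
  · simp [ENNReal.zero_rpow_of_pos hp]
  · rw [ENNReal.ofReal_rpow_of_pos hd, one_div, ← ENNReal.ofReal_inv_of_pos (by positivity)]
    refine ENNReal.ofReal_le_ofReal ?_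
    rw [← Real.rpow_neg hd.le, Real.rpow_def_of_pos hd, Real.rpow_def_of_pos (by norm_num),
      ← Real.exp_add, Real.exp_le_exp]
    have h := Real.log_le_sub_one_of_pos (show 0 < 5 * d ^ 2 by positivity)
    rw [Real.log_mul (by norm_num) (by positivity), Real.log_pow] at h
    push_cast at h
    nlinarith

/-- Modulo five, every unordered pair differs by `1` or `2` in exactly one direction. -/
theorem sum_offDiag_fin_five (g : Fin 5 → Fin 5 → ℝ) (hg : ∀ i j, g i j = g j i) :
    ∑ ij ∈ (Finset.univ : Finset (Fin 5)).offDiag, g ij.1 ij.2 =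
      2 * ∑ i, (g i (i + 1) + g i (i + 2)) := by
  have : (Finset.univ : Finset (Fin 5)).offDiag =
      (Finset.univ ×ˢ Finset.univ).filter fun ij ↦ ij.1 ≠ ij.2 := by decide
  rw [this, Finset.sum_filter, Finset.sum_product]
  simp [Fin.sum_univ_five]
  linarith [hg 0 1, hg 0 2, hg 0 3, hg 0 4, hg 1 2, hg 1 3, hg 1 4, hg 2 3, hg 2 4, hg 3 4]

theorem FlatTorus.dist_sq (z w : FlatTorus) :
    dist z w ^ 2 = ‖w.fst - z.fst‖ ^ 2 + ‖w.snd - z.snd‖ ^ 2 := by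
  rw [WithLp.prod_dist_eq_of_L2, Real.sq_sqrt (by positivity), dist_comm, dist_comm z.snd,
    dist_eq_norm, dist_eq_norm]

theorem sum_exp_le_of_rieszEnergy_le {z : Fin 5 → FlatTorus} {p : ℝ} (hp : 0 < p)
    (h : rieszEnergy p z ≤ 20 * (5 : ℝ≥0∞) ^ (p / 2)) :
    ∑ i, (Real.exp (p / 2 * (1 - 5 * dist (z i) (z (i + 1)) ^ 2)) +
      Real.exp (p / 2 * (1 - 5 * dist (z i) (z (i + 2)) ^ 2))) ≤ 10 := by
  have h5 : (0 : ℝ) < 5 ^ (p / 2) := by positivity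
  have h20 : 20 * (5 : ℝ≥0∞) ^ (p / 2) = ENNReal.ofReal (20 * 5 ^ (p / 2)) := by
    rw [ENNReal.ofReal_mul (by norm_num), ← ENNReal.ofReal_rpow_of_pos (by norm_num)]
    norm_num
  have h1 : ENNReal.ofReal (∑ ij ∈ (Finset.univ : Finset (Fin 5)).offDiag,
      5 ^ (p / 2) * Real.exp (p / 2 * (1 - 5 * dist (z ij.1) (z ij.2) ^ 2))) ≤
      ENNReal.ofReal (20 * 5 ^ (p / 2)) := by
    rw [ENNReal.ofReal_sum_of_nonneg fun _ _ ↦ by positivity, ← h20]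
    refine (Finset.sum_le_sum fun ij _ ↦ ?_).trans h
    rw [edist_dist]
    exact ofReal_exp_le_one_div_rpow dist_nonneg hp
  rw [ENNReal.ofReal_le_ofReal_iff (by positivity), ← Finset.mul_sum, mul_comm,
    sum_offDiag_fin_five (fun i j ↦ Real.exp (p / 2 * (1 - 5 * dist (z i) (z j) ^ 2)))
      fun i j ↦ by rw [dist_comm]] at h1
  linarith [le_of_mul_le_mul_right h1 h5]

theorem rieszEnergy_comp_equiv {n : ℕ} (p : ℝ) (x : Fin n → FlatTorus) (σ : Equiv.Perm (Fin n)) :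
    rieszEnergy p (x ∘ σ) = rieszEnergy p x := by
  refine Finset.sum_equiv (Equiv.prodCongr σ σ) ?_ fun _ _ ↦ rfl
  simp

/-! ### Isometric copies of the Fibonacci set -/

/-- The isometry of the torus acting on the two coordinates separately. -/
noncomputable def FlatTorus.prodIsometry (σ τ : UnitAddCircle ≃ᵢ UnitAddCircle) :
    FlatTorus ≃ᵢ FlatTorus :=
  IsometryEquiv.mk' (fun z ↦ WithLp.toLp 2 (σ z.fst, τ z.snd))
    (fun z ↦ WithLp.toLp 2 (σ.symm z.fst, τ.symm z.snd)) (fun z ↦ by simp; rfl)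
    (Isometry.of_dist_eq fun z w ↦ by
      simp [WithLp.prod_dist_eq_of_L2, σ.dist_eq, τ.dist_eq])

/-- The points of the Fibonacci set, as an orbit of the rotation by `(1 / 5, 3 / 5)`. -/
noncomputable def fibonacciPoint (k : Fin 5) : FlatTorus :=
  torusPoint ((k : ℕ) / 5) (3 * (k : ℕ) / 5)

theorem torusPoint_eq_of_eq_add_nat {a b b' : ℝ} (n : ℕ) (h : b' = b + n) :
    torusPoint a b' = torusPoint a b := by
  have : ((n : ℝ) : UnitAddCircle) = 0 := (AddCircle.coe_eq_zero_iff 1).2 ⟨n, by simp⟩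
  rw [h, torusPoint, torusPoint, AddCircle.coe_add, this, add_zero]

theorem range_fibonacciPoint : Set.range fibonacciPoint = fibonacciSet := by
  have h0 : fibonacciPoint 0 = torusPoint 0 0 := by simp [fibonacciPoint]
  have h1 : fibonacciPoint 1 = torusPoint (1 / 5) (3 / 5) := by simp [fibonacciPoint]
  have h2 : fibonacciPoint 2 = torusPoint (2 / 5) (1 / 5) :=
    torusPoint_eq_of_eq_add_nat 1 (by norm_num)
  have h3 : fibonacciPoint 3 = torusPoint (3 / 5) (4 / 5) :=
    torusPoint_eq_of_eq_add_nat 1 (by norm_num)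
  have h4 : fibonacciPoint 4 = torusPoint (4 / 5) (2 / 5) :=
    torusPoint_eq_of_eq_add_nat 2 (by norm_num)
  rw [fibonacciSet, ← h0, ← h1, ← h2, ← h3, ← h4]
  refine Set.Subset.antisymm ?_ ?_
  · rintro _ ⟨k, rfl⟩
    fin_cases k <;> simp
  · rintro _ (rfl | rfl | rfl | rfl | rfl) <;> exact Set.mem_range_self _

theorem dist_torusPoint_sq (a b c d : ℝ) : dist (torusPoint a b) (torusPoint c d) ^ 2 =
    |c - a - round (c - a)| ^ 2 + |d - b - round (d - b)| ^ 2 := by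
  rw [FlatTorus.dist_sq, ← UnitAddCircle.norm_eq, ← UnitAddCircle.norm_eq]
  rfl

theorem dist_fibonacciPoint {k l : Fin 5} (h : k ≠ l) :
    dist (fibonacciPoint k) (fibonacciPoint l) = √(1 / 5) := by
  rw [eq_comm, Real.sqrt_eq_iff_eq_sq (by norm_num) dist_nonneg, fibonacciPoint, fibonacciPoint,
    dist_torusPoint_sq]
  fin_cases k <;> fin_cases l <;> first | exact absurd rfl h | norm_num [round_eq]

theorem rieszEnergy_of_range_eq {x : Fin 5 → FlatTorus} {φ : FlatTorus ≃ᵢ FlatTorus}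
    (h : Set.range x = φ '' fibonacciSet) (p : ℝ) :
    rieszEnergy p x = 20 * (5 : ℝ≥0∞) ^ (p / 2) := by
  have hinj : Function.Injective fibonacciPoint := fun k l hkl ↦ by
    by_contra hne
    have := dist_fibonacciPoint hne
    rw [hkl, dist_self, eq_comm, Real.sqrt_eq_zero'] at this
    norm_num at this
  rw [← range_fibonacciPoint, ← Set.range_comp] at h
  choose g hg using fun k ↦ h.symm ▸ Set.mem_range_self (f := φ ∘ fibonacciPoint) k
  have hg_bij : Function.Bijective g := Finite.injective_iff_bijective.1 fun k l hkl ↦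
    (φ.injective.comp hinj) (by rw [← hg, ← hg, hkl])
  have hterm : ∀ ij ∈ (Finset.univ : Finset (Fin 5)).offDiag,
      1 / edist (x ij.1) (x ij.2) ^ p = (5 : ℝ≥0∞) ^ (p / 2) := by
    rintro ⟨i, j⟩ hij
    obtain ⟨k, rfl⟩ := hg_bij.2 i
    obtain ⟨l, rfl⟩ := hg_bij.2 j
    have hkl : k ≠ l := fun hkl ↦ by simp [hkl] at hij
    rw [hg, hg, Function.comp_apply, Function.comp_apply, φ.edist_eq, edist_dist,
      dist_fibonacciPoint hkl, Real.sqrt_eq_rpow, ← ENNReal.ofReal_rpow_of_pos (by norm_num),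
      one_div (5 : ℝ), ENNReal.ofReal_inv_of_pos (by norm_num), ← ENNReal.rpow_mul,
      ENNReal.inv_rpow, one_div, inv_inv, show 1 / 2 * p = p / 2 by ring]
    norm_num
  rw [rieszEnergy, Finset.sum_congr rfl hterm, Finset.sum_const, Finset.offDiag_card]
  simp

theorem eq_add_nsmul_of_cyclic {M : Type*} [AddCommGroup M] {x : Fin 5 → M} {c : M}
    (h : ∀ i, x (i + 1) - x i = c) (k : Fin 5) : x k = x 0 + (k : ℕ) • c := by
  have h1 : x 1 = x 0 + c := sub_eq_iff_eq_add'.1 (h 0)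
  have h2 : x 2 = x 1 + c := sub_eq_iff_eq_add'.1 (h 1)
  have h3 : x 3 = x 2 + c := sub_eq_iff_eq_add'.1 (h 2)
  have h4 : x 4 = x 3 + c := sub_eq_iff_eq_add'.1 (h 3)
  fin_cases k <;> simp [h4, h3, h2, h1] <;> abel

/-- The vertical step of `fibonacciPoint` is `3/5`, which is `-2/5` modulo one. So `ε = -1` needs
only a translation, and `ε = 1` also a reflection of the second coordinate. -/
theorem exists_isometry_of_increments {z : Fin 5 → FlatTorus} {ε : ℝ} (hε : ε = 1 ∨ ε = -1)
    (h : ∀ i, (z (i + 1)).fst - (z i).fst = ((1 / 5 : ℝ) : UnitAddCircle) ∧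
      (z (i + 1)).snd - (z i).snd = ((ε * (2 / 5) : ℝ) : UnitAddCircle)) :
    ∃ φ : FlatTorus ≃ᵢ FlatTorus, Set.range z = φ '' fibonacciSet := by
  have hx := eq_add_nsmul_of_cyclic fun i ↦ (h i).1
  have hy := eq_add_nsmul_of_cyclic fun i ↦ (h i).2
  have hnat (n : ℕ) : ((n : ℝ) : UnitAddCircle) = 0 :=
    (AddCircle.coe_eq_zero_iff 1).2 ⟨n, by simp⟩
  have hfst (k : Fin 5) : (z k).fst = (z 0).fst + (((k : ℕ) / 5 : ℝ) : UnitAddCircle) := by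
    rw [hx k, ← AddCircle.coe_nsmul, nsmul_eq_mul, mul_one_div]
  suffices ∃ φ : FlatTorus ≃ᵢ FlatTorus, z = φ ∘ fibonacciPoint by
    obtain ⟨φ, rfl⟩ := this
    exact ⟨φ, by rw [Set.range_comp, range_fibonacciPoint]⟩
  rcases hε with rfl | rfl
  · refine ⟨FlatTorus.prodIsometry (IsometryEquiv.addLeft (z 0).fst)
      ((IsometryEquiv.neg _).trans (IsometryEquiv.addLeft (z 0).snd)), funext fun k ↦ ?_⟩
    refine (WithLp.ofLp_injective 2) (Prod.ext (hfst k) ((hy k).trans ?_))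
    show _ = (z 0).snd + -((3 * (k : ℕ) / 5 : ℝ) : UnitAddCircle)
    rw [← AddCircle.coe_nsmul, ← AddCircle.coe_neg, nsmul_eq_mul,
      show ((k : ℕ) : ℝ) * (1 * (2 / 5)) = -(3 * (k : ℕ) / 5) + (k : ℕ) by ring,
      AddCircle.coe_add, hnat, add_zero]
  · refine ⟨FlatTorus.prodIsometry (IsometryEquiv.addLeft (z 0).fst)
      (IsometryEquiv.addLeft (z 0).snd), funext fun k ↦ ?_⟩
    refine (WithLp.ofLp_injective 2) (Prod.ext (hfst k) ((hy k).trans ?_))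
    show _ = (z 0).snd + ((3 * (k : ℕ) / 5 : ℝ) : UnitAddCircle)
    rw [← AddCircle.coe_nsmul, nsmul_eq_mul,
      show ((k : ℕ) : ℝ) * (-1 * (2 / 5)) = 3 * (k : ℕ) / 5 - (k : ℕ) by ring,
      AddCircle.coe_sub, hnat, sub_zero]

theorem exists_sorted_lift (x : Fin 5 → UnitAddCircle) :
    ∃ (σ : Equiv.Perm (Fin 5)) (a : Fin 5 → ℝ), (∀ i, 0 ≤ a i) ∧ ∑ i, a i = 1 ∧
      ∀ i, (a i : UnitAddCircle) = x (σ (i + 1)) - x (σ i) := by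
  have hlift (c : UnitAddCircle) : ∃ t : ℝ, 0 ≤ t ∧ t ≤ 1 ∧ (t : UnitAddCircle) = c := by
    induction c using QuotientAddGroup.induction_on with
    | H t =>
      refine ⟨Int.fract t, Int.fract_nonneg t, (Int.fract_lt_one t).le, ?_⟩
      rw [Int.fract, AddCircle.coe_sub, sub_eq_self]
      exact (AddCircle.coe_eq_zero_iff 1).2 ⟨⌊t⌋, by simp⟩
  choose X hX₀ hX₁ hX using fun i ↦ hlift (x i)
  set σ := Tuple.sort X
  have hmono : Monotone (X ∘ σ) := Tuple.monotone_sort X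
  -- At `i = 4` the index wraps to `0`, so one full turn is added to keep the gap nonnegative.
  refine ⟨σ, fun i ↦ X (σ (i + 1)) - X (σ i) + if i = 4 then 1 else 0, fun i ↦ ?_, ?_, fun i ↦ ?_⟩
  · dsimp only
    split_ifs with hi
    · linarith [hX₀ (σ (i + 1)), hX₁ (σ i)]
    · have : i ≤ i + 1 := by revert i; decide
      linarith [show X (σ i) ≤ X (σ (i + 1)) from hmono this]
  · rw [Finset.sum_add_distrib, sum_sub_cyclic fun i ↦ X (σ i)]
    simp
  · rw [AddCircle.coe_add, AddCircle.coe_sub, hX, hX]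
    split_ifs
    · rw [AddCircle.coe_period 1, add_zero]
    · rw [AddCircle.coe_zero, add_zero]

theorem exists_isometry_of_rieszEnergy_le {p : ℝ} (hp : 20000 ≤ p) {x : Fin 5 → FlatTorus}
    (h : rieszEnergy p x ≤ 20 * (5 : ℝ≥0∞) ^ (p / 2)) :
    ∃ φ : FlatTorus ≃ᵢ FlatTorus, Set.range x = φ '' fibonacciSet := by
  obtain ⟨σ, a, ha, hsum, hax⟩ := exists_sorted_lift fun i ↦ (x i).fst
  rw [← rieszEnergy_comp_equiv p x σ] at h
  have hexp := sum_exp_le_of_rieszEnergy_le (by linarith) h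
  simp only [FlatTorus.dist_sq] at hexp
  obtain ⟨ε, hε, hinc⟩ := increments_eq_of_sum_exp_le
    (x := fun i ↦ ((x ∘ σ) i).fst) (y := fun i ↦ ((x ∘ σ) i).snd) ha hsum hax
    (by linarith : 10000 ≤ p / 2) hexp
  have := exists_isometry_of_increments hε hinc
  rwa [σ.surjective.range_comp] at this

theorem theorem4 :
    ∃ p₀ : ℝ, 0 < p₀ ∧ ∀ p : ℝ, p₀ ≤ p → ∀ x : Fin 5 → FlatTorus,
      20 * (5 : ℝ≥0∞) ^ (p / 2) ≤ rieszEnergy p x ∧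
      (rieszEnergy p x = 20 * (5 : ℝ≥0∞) ^ (p / 2) ↔
        ∃ φ : FlatTorus ≃ᵢ FlatTorus, Set.range x = φ '' fibonacciSet) := by
  refine ⟨20000, by norm_num, fun p hp x ↦ ⟨?_, ?_, ?_⟩⟩
  · by_contra! hlt
    obtain ⟨φ, hφ⟩ := exists_isometry_of_rieszEnergy_le hp hlt.le
    exact hlt.ne (rieszEnergy_of_range_eq hφ p)
  · exact fun h ↦ exists_isometry_of_rieszEnergy_le hp h.le
  · rintro ⟨φ, hφ⟩
    exact rieszEnergy_of_range_eq hφ p
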